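/- Let $\Phi:\mathbb{R}^d\to\mathbb{R}$ be convex and twice continuously differentiable with a nonempty set of global minimizers. Let $p\in\{1,2,\dots\}$, $\theta\in(0,1)$, $c>0$, let $x_0\in\mathbb{R}^d$ satisfy $\nabla\Phi(x_0)\neq 0$, and let $w_0\in\mathbb{R}^d$. For an interval $J=[0,T)$ with $0<T\le+\infty$, a solution on $J$ of the closed-loop control system is a triple $(x,\lambda,a):J\to\mathbb{R}^d\times(0,+\infty)\times(0,+\infty)$, with $x$ and $a$ of class $C^2$ and $\lambda$ continuous on $J$ (derivatives at $0$ are one-sided), such that for all $t\in J$ $$\ddot x(t)+\alpha(t)\dot x(t)+\beta(t)\nabla^2\Phi(x(t))\dot x(t)+b(t)\nabla\Phi(x(t))=0,$$ $$\alpha(t)=\frac{2\dot a(t)}{a(t)}-\frac{\ddot a(t)}{\dot a(t)},\qquad \beta(t)=\frac{(\dot a(t))^2}{a(t)},\qquad b(t)=\frac{\dot a(t)(\dot a(t)+\ddot a(t))}{a(t)},$$ $$a(t)=\tfrac14\Big(\int_0^t\sqrt{\lambda(s)}\,ds+c\Big)^2,\qquad (\lambda(t))^p\,\|\nabla\Phi(x(t))\|^{p-1}=\theta,$$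 and $x(0)=x_0$, $\dot x(0)=w_0$ (for $p=1$ the equation linking $\lambda$ and $x$ reads $\lambda(t)=\theta$). Suppose that $\lambda$ is absolutely continuous on bounded intervals, in the following sense: for every finite $T>0$ and every solution $(x,\lambda,a)$ on $[0,T)$, the function $\lambda$ is absolutely continuous on $[0,T)$. Then the closed-loop control system has a unique global solution $(x,\lambda,a):[0,+\infty)\to\mathbb{R}^d\times(0,+\infty)\times(0,+\infty)$; that is, a solution on $[0,+\infty)$ exists, and any two solutions on $[0,+\infty)$ are equal. -/

import Mathlib

open Set

noncomputable section

namespace ClosedLoop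

/-- Absolute continuity of `f` on an interval `I` of the real line, which may be open, half-open or
closed: for every `ε > 0` there is `δ > 0` such that any finite family of non-overlapping compact
subintervals `[u i, v i] ⊆ I` of total length `< δ` satisfies `∑ i, |f (v i) - f (u i)| < ε`. -/
def AbsContOn (f : ℝ → ℝ) (I : Set ℝ) : Prop :=
  ∀ ε > 0, ∃ δ > 0, ∀ (n : ℕ) (u v : Fin n → ℝ),
    (∀ i, u i ≤ v i ∧ Icc (u i) (v i) ⊆ I) →
    (∀ i j, i ≠ j → Disjoint (Ioo (u i) (v i)) (Ioo (u j) (v j))) →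
    ∑ i, (v i - u i) < δ →
    ∑ i, |f (v i) - f (u i)| < ε

variable {F : Type*} [NormedAddCommGroup F] [NormedSpace ℝ F]

/-- The first time derivative, on the time interval `J` (one-sided at an end point of `J`). -/
def dot (J : Set ℝ) (f : ℝ → F) (t : ℝ) : F := derivWithin f J t

/-- The second time derivative, on the time interval `J` (one-sided at an end point of `J`). -/
def ddot (J : Set ℝ) (f : ℝ → F) (t : ℝ) : F := derivWithin (derivWithin f J) J t

/-- `α(t) = 2 ȧ(t) / a(t) - ä(t) / ȧ(t)`. -/
def coeffα (J : Set ℝ) (a : ℝ → ℝ) (t : ℝ) : ℝ :=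
  2 * dot J a t / a t - ddot J a t / dot J a t

/-- `β(t) = ȧ(t)² / a(t)`. -/
def coeffβ (J : Set ℝ) (a : ℝ → ℝ) (t : ℝ) : ℝ := (dot J a t) ^ 2 / a t

/-- `b(t) = ȧ(t) (ȧ(t) + ä(t)) / a(t)`. -/
def coeffb (J : Set ℝ) (a : ℝ → ℝ) (t : ℝ) : ℝ :=
  dot J a t * (dot J a t + ddot J a t) / a t

/-- `(x, lam, a)` is a classical solution, on the time interval `J` (with `0 ∈ J ⊆ [0, ∞)`), of the
closed-loop control system with parameters `Φ`, `p`, `θ`, `c` and initial data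
`x(0) = x₀`, `ẋ(0) = w₀`. -/
structure IsSolution {d : ℕ} (Φ : EuclideanSpace ℝ (Fin d) → ℝ) (p : ℕ) (θ c : ℝ)
    (x₀ w₀ : EuclideanSpace ℝ (Fin d)) (J : Set ℝ)
    (x : ℝ → EuclideanSpace ℝ (Fin d)) (lam a : ℝ → ℝ) : Prop where
  x_smooth : ContDiffOn ℝ 2 x J
  a_smooth : ContDiffOn ℝ 2 a J
  lam_cont : ContinuousOn lam J
  lam_pos : ∀ t ∈ J, 0 < lam t
  a_pos : ∀ t ∈ J, 0 < a t
  /-- `ẍ + α ẋ + β ∇²Φ(x) ẋ + b ∇Φ(x) = 0` -/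
  ode : ∀ t ∈ J,
    ddot J x t + coeffα J a t • dot J x t
      + coeffβ J a t • (fderiv ℝ (gradient Φ) (x t)) (dot J x t)
      + coeffb J a t • gradient Φ (x t) = 0
  /-- `a(t) = ¼ (∫₀ᵗ √λ(s) ds + c)²` -/
  a_eq : ∀ t ∈ J, a t = 1 / 4 * ((∫ s in (0 : ℝ)..t, √(lam s)) + c) ^ 2
  /-- `λ(t)ᵖ ‖∇Φ(x(t))‖ᵖ⁻¹ = θ`; for `p = 1` this reads `λ(t) = θ`. -/
  feedback : ∀ t ∈ J, lam t ^ p * ‖gradient Φ (x t)‖ ^ (p - 1) = θ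
  init_pos : x 0 = x₀
  init_vel : dot J x 0 = w₀

end ClosedLoop

end

/-! With `v = x + (a / ȧ) ẋ + ȧ ∇Φ(x)` the second-order equation becomes `v̇ = -ȧ ∇Φ(x)`: the three
coefficients are those produced by differentiating `v`. With `s = 2 √a`, `ṡ = √λ`, and the feedback
law makes `√λ` a function `rate` of `x` alone. So `(x, v, s)` follows an autonomous field that
contains `∇Φ` but no Hessian, hence is C¹ on the open set where `s > 0` and `λ` is determined.
Uniqueness is then that of a locally Lipschitz ODE.

Global existence requires confinement to a compact part of the domain on each bounded interval
(`exists_isCurveIn_Ici`). Absolute continuity bounds `λ`, which bounds `s` and, for `p > 1`, keeps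
`∇Φ` away from zero. The energy `a (Φ(x) - Φ(z)) + ‖v - z‖² / 2`, with `z` a minimizer, decreases
and bounds `v`; a second monotone quantity then bounds `x` (`exists_isCompact_mapsTo`). -/

noncomputable section

namespace ClosedLoop

open Filter Topology

/-! ### Maximal integral curves of a C¹ field on an open set -/

section Flow

variable {E : Type*} [NormedAddCommGroup E] [NormedSpace ℝ E]

/-- `u` is an integral curve of the vector field `f` on the time set `J`, with values in `U`. -/
def IsCurveIn (f : E → E) (U : Set E) (J : Set ℝ) (u : ℝ → E) : Prop :=
  ∀ t ∈ J, u t ∈ U ∧ HasDerivWithinAt u (f (u t)) J t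

lemma IsCurveIn.continuousOn {f : E → E} {U : Set E} {J : Set ℝ} {u : ℝ → E}
    (h : IsCurveIn f U J u) : ContinuousOn u J :=
  fun t ht => (h t ht).2.continuousWithinAt

lemma IsCurveIn.mono {f : E → E} {U : Set E} {J J' : Set ℝ} {u : ℝ → E}
    (h : IsCurveIn f U J u) (hJ : J' ⊆ J) : IsCurveIn f U J' u :=
  fun t ht => ⟨(h t (hJ ht)).1, (h t (hJ ht)).2.mono hJ⟩

lemma exists_lipschitzOnWith_of_contDiffOn {f : E → E} {U : Set E} (hU : IsOpen U)
    (hf : ContDiffOn ℝ 1 f U) {K : Set E} (hK : IsCompact K) (hKU : K ⊆ U) :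
    ∃ C, LipschitzOnWith C f K := by
  refine LocallyLipschitzOn.exists_lipschitzOnWith_of_compact hK fun x hx => ?_
  obtain ⟨C, s, hs, h⟩ := (hf.contDiffAt (hU.mem_nhds (hKU hx))).exists_lipschitzOnWith
  exact ⟨C, s, mem_nhdsWithin_of_mem_nhds hs, h⟩

/-- Up to time `t` both curves stay in one compact subset of `U`, where `f` has a Lipschitz
constant, so Grönwall applies; `U` need not be convex. -/
lemma IsCurveIn.eqOn_Ico {f : E → E} {U : Set E} (hU : IsOpen U) (hf : ContDiffOn ℝ 1 f U)
    {T : ℝ} {u v : ℝ → E} (hu : IsCurveIn f U (Ico 0 T) u) (hv : IsCurveIn f U (Ico 0 T) v)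
    (h0 : u 0 = v 0) : EqOn u v (Ico 0 T) := by
  intro t ht
  have hsub : Icc 0 t ⊆ Ico 0 T := fun s hs => ⟨hs.1, hs.2.trans_lt ht.2⟩
  have hK : IsCompact (u '' Icc 0 t ∪ v '' Icc 0 t) :=
    (isCompact_Icc.image_of_continuousOn (hu.continuousOn.mono hsub)).union
      (isCompact_Icc.image_of_continuousOn (hv.continuousOn.mono hsub))
  have hKU : u '' Icc 0 t ∪ v '' Icc 0 t ⊆ U := by
    rintro _ (⟨s, hs, rfl⟩ | ⟨s, hs, rfl⟩)
    exacts [(hu s (hsub hs)).1, (hv s (hsub hs)).1]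
  obtain ⟨C, hC⟩ := exists_lipschitzOnWith_of_contDiffOn hU hf hK hKU
  have key : ∀ {w : ℝ → E}, IsCurveIn f U (Ico 0 T) w → ∀ s ∈ Ico 0 t,
      HasDerivWithinAt w (f (w s)) (Ici s) s := by
    intro w hw s hs
    refine (hw s ⟨hs.1, hs.2.trans ht.2⟩).2.mono_of_mem_nhdsWithin ?_
    filter_upwards [self_mem_nhdsWithin, mem_nhdsWithin_of_mem_nhds
      (Iio_mem_nhds (hs.2.trans ht.2))] with r hr hr'
    exact ⟨hs.1.trans hr, hr'⟩
  exact ODE_solution_unique_of_mem_Icc_right (v := fun _ => f)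
    (s := fun _ => u '' Icc 0 t ∪ v '' Icc 0 t) (fun _ _ => hC)
    (hu.continuousOn.mono hsub) (key hu)
    (fun s hs => Or.inl (mem_image_of_mem _ (Ico_subset_Icc_self hs)))
    (hv.continuousOn.mono hsub) (key hv)
    (fun s hs => Or.inr (mem_image_of_mem _ (Ico_subset_Icc_self hs))) h0 ⟨ht.1, le_rfl⟩

lemma IsCurveIn.eqOn_Ici {f : E → E} {U : Set E} (hU : IsOpen U) (hf : ContDiffOn ℝ 1 f U)
    {u v : ℝ → E} (hu : IsCurveIn f U (Ici 0) u) (hv : IsCurveIn f U (Ici 0) v)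
    (h0 : u 0 = v 0) : EqOn u v (Ici 0) := fun t ht =>
  (hu.mono Ico_subset_Ici_self).eqOn_Ico hU hf (T := t + 1) (hv.mono Ico_subset_Ici_self) h0
    ⟨ht, lt_add_one t⟩

/-- Compatible curves on half-open intervals glue to a curve on their union. -/
lemma exists_isCurveIn_of_forall {f : E → E} {U : Set E} (hU : IsOpen U)
    (hf : ContDiffOn ℝ 1 f U) {u₀ : E} {J : Set ℝ} (hJ : J ⊆ Ici 0) (h0J : (0 : ℝ) ∈ J)
    (h : ∀ t ∈ J, ∃ T, t < T ∧ ∃ u, u 0 = u₀ ∧ IsCurveIn f U (Ico 0 T) u) :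
    ∃ u, u 0 = u₀ ∧ IsCurveIn f U J u := by
  choose! T hT w hw0 hw using h
  -- By uniqueness the local curves agree on common intervals, so near `t` the diagonal `s ↦ w s s`
  -- coincides with the single curve `w t`.
  have key : ∀ t ∈ J, ∀ s ∈ J, s < T t → w s s = w t s := by
    intro t ht s hs hst
    refine ((hw s hs).mono (Ico_subset_Ico_right (min_le_left _ _))).eqOn_Ico hU hf
      (T := min (T s) (T t)) ((hw t ht).mono (Ico_subset_Ico_right (min_le_right _ _)))
      ((hw0 s hs).trans (hw0 t ht).symm) ⟨hJ hs, lt_min (hT s hs) hst⟩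
  refine ⟨fun t => w t t, hw0 0 h0J, fun t ht => ⟨(hw t ht t ⟨hJ ht, hT t ht⟩).1, ?_⟩⟩
  have hd := (hw t ht t ⟨hJ ht, hT t ht⟩).2
  have hnhds : Iio (T t) ∈ 𝓝[J] t := mem_nhdsWithin_of_mem_nhds (Iio_mem_nhds (hT t ht))
  have hd' : HasDerivWithinAt (w t) (f (w t t)) J t := by
    refine hd.mono_of_mem_nhdsWithin ?_
    filter_upwards [hnhds, self_mem_nhdsWithin] with s hs hs'
    exact ⟨hJ hs', hs⟩
  refine hd'.congr_of_eventuallyEq ?_ rfl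
  filter_upwards [hnhds, self_mem_nhdsWithin] with s hs hs'
  exact key t ht s hs' hs

/-- Concatenation of two curves. -/
lemma IsCurveIn.concat {f : E → E} {U : Set E} {t T T' : ℝ} {u v : ℝ → E}
    (hu : IsCurveIn f U (Ico 0 T) u) (h0t : 0 ≤ t) (htT : t < T)
    (hv : IsCurveIn f U (Ico t T') v) (huv : u t = v t) :
    IsCurveIn f U (Ico 0 T') (fun s => if s < t then u s else v s) := by
  set w : ℝ → E := fun s => if s < t then u s else v s with hw
  have hwu : EqOn w u (Icc 0 t) := fun s hs => by
    rcases hs.2.lt_or_eq with h | rfl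
    · exact if_pos h
    · simp [hw, huv]
  have hwv : EqOn w v (Ici t) := fun s hs => if_neg (not_lt.2 hs)
  have hleft : ∀ s ∈ Icc 0 t, w s ∈ U ∧ HasDerivWithinAt w (f (w s)) (Icc 0 t) s := by
    intro s hs
    have hs' : s ∈ Ico 0 T := ⟨hs.1, hs.2.trans_lt htT⟩
    rw [hwu hs]
    exact ⟨(hu s hs').1, ((hu s hs').2.mono fun r hr => ⟨hr.1, hr.2.trans_lt htT⟩).congr hwu
      (hwu hs)⟩
  have hright : ∀ s ∈ Ico t T', w s ∈ U ∧ HasDerivWithinAt w (f (w s)) (Ico t T') s := by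
    intro s hs
    rw [hwv hs.1]
    exact ⟨(hv s hs).1, (hv s hs).2.congr (fun r hr => hwv hr.1) (hwv hs.1)⟩
  intro s hs
  rcases lt_trichotomy s t with hst | rfl | hst
  · have h := hleft s ⟨hs.1, hst.le⟩
    refine ⟨h.1, h.2.mono_of_mem_nhdsWithin ?_⟩
    filter_upwards [mem_nhdsWithin_of_mem_nhds (Iio_mem_nhds hst), self_mem_nhdsWithin]
      with r hr hr'
    exact ⟨hr'.1, le_of_lt hr⟩
  · have h := hleft s ⟨hs.1, le_rfl⟩
    refine ⟨h.1, (h.2.union (hright s ⟨le_rfl, hs.2⟩).2).mono fun r hr => ?_⟩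
    rcases le_total r s with h | h
    · exact Or.inl ⟨hr.1, h⟩
    · exact Or.inr ⟨h, hr.2⟩
  · have h := hright s ⟨hst.le, hs.2⟩
    refine ⟨h.1, h.2.mono_of_mem_nhdsWithin ?_⟩
    filter_upwards [mem_nhdsWithin_of_mem_nhds (Ioi_mem_nhds hst), self_mem_nhdsWithin]
      with r hr hr'
    exact ⟨le_of_lt hr, hr'.2⟩

/-- Local existence, uniformly near a point of `U`. -/
lemma exists_isCurveIn_nhds [CompleteSpace E] {f : E → E} {U : Set E} (hU : IsOpen U)
    (hf : ContDiffOn ℝ 1 f U) {y : E} (hy : y ∈ U) :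
    ∃ V ∈ 𝓝 y, ∃ ε > 0, ∀ z ∈ V, ∀ t : ℝ, ∃ v, v t = z ∧ IsCurveIn f U (Ico t (t + ε)) v := by
  obtain ⟨ε, hε, a, r, _, _, hr, hpl⟩ :=
    IsPicardLindelof.of_contDiffAt_one (hf.contDiffAt (hU.mem_nhds hy))
  obtain ⟨α, hα, hcont⟩ := (hpl 0).exists_forall_mem_closedBall_eq_hasDerivWithinAt_continuousOn
  have hball : Metric.closedBall y (r : ℝ) ∈ 𝓝 y := Metric.closedBall_mem_nhds y hr
  have hIcc : Icc (0 - ε) (0 + ε) ∈ 𝓝 (0 : ℝ) := Icc_mem_nhds (by linarith) (by linarith)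
  have hca : ContinuousAt α (y, 0) := hcont.continuousAt (prod_mem_nhds hball hIcc)
  have hmem : α ⁻¹' U ∈ 𝓝 y ×ˢ 𝓝 (0 : ℝ) := by
    rw [← nhds_prod_eq]
    refine hca.preimage_mem_nhds (hU.mem_nhds ?_)
    rwa [(hα y (mem_of_mem_nhds hball)).1]
  obtain ⟨V, hV, W, hW, hVW⟩ := mem_prod_iff.1 hmem
  obtain ⟨δ, hδ, hδW⟩ := Metric.mem_nhds_iff.1 (inter_mem hW hIcc)
  refine ⟨V ∩ Metric.closedBall y r, inter_mem hV hball, δ, hδ, fun z hz t =>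
    ⟨fun s => α (z, s - t), by simpa using (hα z hz.2).1, fun s hs => ?_⟩⟩
  have hsub : ∀ q ∈ Ico t (t + δ), q - t ∈ W ∩ Icc (0 - ε) (0 + ε) := fun q hq =>
    hδW (by rw [Metric.mem_ball, Real.dist_0_eq_abs, abs_lt]; constructor <;> linarith [hq.1, hq.2])
  refine ⟨hVW ⟨hz.1, (hsub s hs).1⟩, ?_⟩
  have h1 := (hα z hz.2).2 (s - t) (hsub s hs).2
  have h2 : HasDerivWithinAt (fun q : ℝ => q - t) 1 (Ico t (t + δ)) s :=
    ((hasDerivAt_id s).sub_const t).hasDerivWithinAt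
  simpa [Function.comp_def] using h1.scomp s h2 (fun q hq => (hsub q hq).2)

/-- An integral curve that cannot leave compact subsets of `U` in finite time is global. -/
theorem exists_isCurveIn_Ici [CompleteSpace E] {f : E → E} {U : Set E} (hU : IsOpen U)
    (hf : ContDiffOn ℝ 1 f U) {u₀ : E} (hu₀ : u₀ ∈ U)
    (h : ∀ T > 0, ∀ u, u 0 = u₀ → IsCurveIn f U (Ico 0 T) u →
      ∃ K, IsCompact K ∧ K ⊆ U ∧ MapsTo u (Ico 0 T) K) :
    ∃ u, u 0 = u₀ ∧ IsCurveIn f U (Ici 0) u := by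
  set S : Set ℝ := {T | 0 < T ∧ ∃ u, u 0 = u₀ ∧ IsCurveIn f U (Ico 0 T) u} with hS
  by_cases hb : BddAbove S
  swap
  · rw [not_bddAbove_iff] at hb
    refine exists_isCurveIn_of_forall hU hf subset_rfl self_mem_Ici fun t _ => ?_
    obtain ⟨T, hT, htT⟩ := hb t
    exact ⟨T, htT, hT.2⟩
  -- If `S` is bounded, the curve on `[0, sSup S)` can be prolonged past `sSup S`.
  exfalso
  have hne : S.Nonempty := by
    obtain ⟨V, hV, ε, hε, H⟩ := exists_isCurveIn_nhds hU hf hu₀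
    obtain ⟨v, hv, hc⟩ := H u₀ (mem_of_mem_nhds hV) 0
    exact ⟨ε, hε, v, hv, by simpa using hc⟩
  have hTpos : 0 < sSup S := hne.some_mem.1.trans_le (le_csSup hb hne.some_mem)
  obtain ⟨u, hu0, hu⟩ : ∃ u, u 0 = u₀ ∧ IsCurveIn f U (Ico 0 (sSup S)) u := by
    refine exists_isCurveIn_of_forall hU hf Ico_subset_Ici_self ⟨le_rfl, hTpos⟩ fun t ht => ?_
    obtain ⟨T, hT, htT⟩ := exists_lt_of_lt_csSup hne ht.2
    exact ⟨T, htT, hT.2⟩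
  obtain ⟨K, hK, hKU, hmaps⟩ := h _ hTpos u hu0 hu
  have hev : ∀ᶠ t in 𝓝[<] (sSup S), t ∈ Ico 0 (sSup S) := Ico_mem_nhdsLT hTpos
  obtain ⟨y, hyK, hy⟩ := hK.exists_clusterPt (f := map u (𝓝[<] (sSup S)))
    (tendsto_principal.2 (hev.mono fun t ht => hmaps ht))
  obtain ⟨V, hV, ε, hε, H⟩ := exists_isCurveIn_nhds hU hf (hKU hyK)
  -- The existence time `ε` is uniform near the cluster point `y`, so restarting at a `t > sSup S -
  -- ε` with `u t` near `y` overshoots the supremum.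
  obtain ⟨t, htV, ht, htε⟩ := ((mapClusterPt_iff_frequently.1 hy V hV).and_eventually
    (hev.and (mem_nhdsWithin_of_mem_nhds
      (Ioi_mem_nhds (show sSup S - ε < sSup S by linarith))))).exists
  obtain ⟨v, hv, hc⟩ := H (u t) htV t
  have hmem : t + ε ∈ S := by
    refine ⟨by linarith [ht.1], _, ?_, hu.concat ht.1 ht.2 hc hv.symm⟩
    rcases ht.1.eq_or_lt with rfl | h0
    · simp [hv, hu0]
    · simp [h0, hu0]
  have := le_csSup hb hmem
  have h3 : sSup S - ε < t := htε
  linarith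

end Flow

/-! ### The first-order field and the averaged position -/

section Reduction

variable {E : Type*} [NormedAddCommGroup E] [InnerProductSpace ℝ E] [CompleteSpace E]

lemma contDiff_gradient {Φ : E → ℝ} (h : ContDiff ℝ 2 Φ) : ContDiff ℝ 1 (gradient Φ) := by
  have h1 : ContDiff ℝ 1 (fderiv ℝ Φ) := h.fderiv_right (by norm_num)
  exact (InnerProductSpace.toDual ℝ E).symm.contDiff.comp h1

/-- `√λ` as a function of the position. -/
def rate (Φ : E → ℝ) (p : ℕ) (θ : ℝ) (x : E) : ℝ :=
  (θ / ‖gradient Φ x‖ ^ (p - 1)) ^ (1 / (2 * p : ℝ))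

/-- The positions at which the feedback law determines `λ`. -/
def regular (Φ : E → ℝ) (p : ℕ) : Set E := {x | 0 < ‖gradient Φ x‖ ^ (p - 1)}

/-- The first-order field governing `(x, v, s)` with
`v = x + (a / ȧ) ẋ + ȧ ∇Φ(x)` and `s = 2 √a`. -/
def field (Φ : E → ℝ) (p : ℕ) (θ : ℝ) (q : E × E × ℝ) : E × E × ℝ :=
  ((2 * rate Φ p θ q.1 / q.2.2) •
      (q.2.1 - q.1 - (q.2.2 * rate Φ p θ q.1 / 2) • gradient Φ q.1),
    -((q.2.2 * rate Φ p θ q.1 / 2) • gradient Φ q.1), rate Φ p θ q.1)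

/-- The domain of `field`. -/
def domain (Φ : E → ℝ) (p : ℕ) : Set (E × E × ℝ) := {q | q.1 ∈ regular Φ p ∧ 0 < q.2.2}

/-- The norm is not smooth at 0, but for `p > 1` the gradient is nonzero on `regular`. For `p = 1`
the power is constantly 1, even at critical points. -/
lemma contDiffOn_rate {Φ : E → ℝ} (hΦ : ContDiff ℝ 2 Φ) (p : ℕ) {θ : ℝ} (hθ : 0 < θ) :
    ContDiffOn ℝ 1 (rate Φ p θ) (regular Φ p) := by
  have hn : ContDiffOn ℝ 1 (fun x => ‖gradient Φ x‖ ^ (p - 1)) (regular Φ p) := by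
    rcases Nat.eq_zero_or_pos (p - 1) with h | h
    · simpa [h] using contDiffOn_const
    · refine ContDiffOn.pow (ContDiffOn.norm ℝ (contDiff_gradient hΦ).contDiffOn fun x hx h0 => ?_) _
      have hx' : 0 < ‖gradient Φ x‖ ^ (p - 1) := hx
      simp [h0, h.ne'] at hx'
  exact (contDiffOn_const.div hn fun x hx => ne_of_gt hx).rpow_const_of_ne
    fun x hx => (div_pos hθ hx).ne'

lemma isOpen_regular {Φ : E → ℝ} (hΦ : ContDiff ℝ 2 Φ) (p : ℕ) : IsOpen (regular Φ p) :=
  isOpen_lt continuous_const ((contDiff_gradient hΦ).continuous.norm.pow _)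

lemma isOpen_domain {Φ : E → ℝ} (hΦ : ContDiff ℝ 2 Φ) (p : ℕ) : IsOpen (domain Φ p) :=
  ((isOpen_regular hΦ p).preimage continuous_fst).inter
    (isOpen_lt continuous_const (continuous_snd.comp continuous_snd))

lemma contDiffOn_field {Φ : E → ℝ} (hΦ : ContDiff ℝ 2 Φ) (p : ℕ) {θ : ℝ} (hθ : 0 < θ) :
    ContDiffOn ℝ 1 (field Φ p θ) (domain Φ p) := by
  have hr : ContDiffOn ℝ 1 (fun q : E × E × ℝ => rate Φ p θ q.1) (domain Φ p) :=
    (contDiffOn_rate hΦ p hθ).comp contDiff_fst.contDiffOn fun q hq => hq.1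
  have hg : ContDiffOn ℝ 1 (fun q : E × E × ℝ => gradient Φ q.1) (domain Φ p) :=
    ((contDiff_gradient hΦ).comp contDiff_fst).contDiffOn
  have hx : ContDiffOn ℝ 1 (fun q : E × E × ℝ => q.1) (domain Φ p) := contDiff_fst.contDiffOn
  have hv : ContDiffOn ℝ 1 (fun q : E × E × ℝ => q.2.1) (domain Φ p) :=
    (contDiff_fst.comp contDiff_snd).contDiffOn
  have hs : ContDiffOn ℝ 1 (fun q : E × E × ℝ => q.2.2) (domain Φ p) :=
    (contDiff_snd.comp contDiff_snd).contDiffOn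
  have hadot : ContDiffOn ℝ 1 (fun q : E × E × ℝ => (q.2.2 * rate Φ p θ q.1 / 2) • gradient Φ q.1)
      (domain Φ p) := ((hs.mul hr).div_const 2).smul hg
  exact (((contDiffOn_const.mul hr).div hs fun q hq => ne_of_gt hq.2).smul
    ((hv.sub hx).sub hadot)).prodMk (hadot.neg.prodMk hr)

lemma rate_pos {Φ : E → ℝ} {p : ℕ} {θ : ℝ} (hθ : 0 < θ) {x : E} (hx : x ∈ regular Φ p) :
    0 < rate Φ p θ x := Real.rpow_pos_of_pos (div_pos hθ hx) _

lemma rate_feedback {Φ : E → ℝ} {p : ℕ} (hp : 1 ≤ p) {θ : ℝ} (hθ : 0 < θ) {x : E}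
    (hx : x ∈ regular Φ p) :
    (rate Φ p θ x ^ 2) ^ p * ‖gradient Φ x‖ ^ (p - 1) = θ := by
  have hx' : 0 < ‖gradient Φ x‖ ^ (p - 1) := hx
  have hp' : (p : ℝ) ≠ 0 := by positivity
  have h : (rate Φ p θ x ^ 2) ^ p = θ / ‖gradient Φ x‖ ^ (p - 1) := by
    rw [← pow_mul, rate, ← Real.rpow_natCast, ← Real.rpow_mul (div_pos hθ hx').le]
    have : 1 / (2 * (p : ℝ)) * ((2 * p : ℕ) : ℝ) = 1 := by push_cast; field_simp
    rw [this, Real.rpow_one]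
  rw [h, div_mul_cancel₀ _ hx'.ne']

lemma mem_regular_of_feedback {Φ : E → ℝ} {p : ℕ} {θ l : ℝ} (hθ : 0 < θ) (hl : 0 < l) {x : E}
    (h : l ^ p * ‖gradient Φ x‖ ^ (p - 1) = θ) : x ∈ regular Φ p :=
  (pos_iff_pos_of_mul_pos (h ▸ hθ)).1 (pow_pos hl p)

lemma rate_sq_eq_of_feedback {Φ : E → ℝ} {p : ℕ} (hp : 1 ≤ p) {θ l : ℝ} (hθ : 0 < θ) (hl : 0 < l)
    {x : E} (h : l ^ p * ‖gradient Φ x‖ ^ (p - 1) = θ) : rate Φ p θ x ^ 2 = l := by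
  have hx := mem_regular_of_feedback hθ hl h
  have := mul_right_cancel₀ (ne_of_gt hx) ((rate_feedback hp hθ hx).trans h.symm)
  exact (pow_left_inj₀ (sq_nonneg _) hl.le (by omega)).1 this

lemma sqrt_eq_rate_of_feedback {Φ : E → ℝ} {p : ℕ} (hp : 1 ≤ p) {θ l : ℝ} (hθ : 0 < θ)
    (hl : 0 < l) {x : E} (h : l ^ p * ‖gradient Φ x‖ ^ (p - 1) = θ) : √l = rate Φ p θ x := by
  rw [← rate_sq_eq_of_feedback hp hθ hl h,
    Real.sqrt_sq (rate_pos hθ (mem_regular_of_feedback hθ hl h)).le]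

/-- The averaged position `x + (a / ȧ) ẋ + ȧ ∇Φ(x)`. -/
def averaged (Φ : E → ℝ) (J : Set ℝ) (x : ℝ → E) (a : ℝ → ℝ) (t : ℝ) : E :=
  x t + (a t / dot J a t) • dot J x t + dot J a t • gradient Φ (x t)

lemma hasDerivWithinAt_dot {F : Type*} [NormedAddCommGroup F] [NormedSpace ℝ F] {J : Set ℝ}
    (hJ : UniqueDiffOn ℝ J) {f : ℝ → F} (hf : ContDiffOn ℝ 2 f J) {t : ℝ} (ht : t ∈ J) :
    HasDerivWithinAt f (dot J f t) J t ∧ HasDerivWithinAt (dot J f) (ddot J f t) J t := by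
  have h : ContDiffOn ℝ (1 + 1) f J := by simpa [one_add_one_eq_two] using hf
  have h1 := (contDiffOn_succ_iff_derivWithin hJ).1 h
  exact ⟨(h1.1 t ht).hasDerivWithinAt,
    ((h1.2.2.differentiableOn one_ne_zero) t ht).hasDerivWithinAt⟩

/-- An identity in which the equation is not assumed: `a / ȧ` is an integrating factor, since `(a /
ȧ) α = 1 + (a / ȧ)'`, `(a / ȧ) β = ȧ` and `(a / ȧ) b = ȧ + ä`. -/
lemma hasDerivWithinAt_averaged {Φ : E → ℝ} (hΦ : ContDiff ℝ 2 Φ) {J : Set ℝ}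
    (hJ : UniqueDiffOn ℝ J) {x : ℝ → E} {a : ℝ → ℝ} (hx : ContDiffOn ℝ 2 x J)
    (ha : ContDiffOn ℝ 2 a J) {t : ℝ} (ht : t ∈ J) (ha0 : a t ≠ 0) (hda0 : dot J a t ≠ 0) :
    HasDerivWithinAt (averaged Φ J x a)
      ((a t / dot J a t) • (ddot J x t + coeffα J a t • dot J x t
        + coeffβ J a t • (fderiv ℝ (gradient Φ) (x t)) (dot J x t)
        + coeffb J a t • gradient Φ (x t)) - dot J a t • gradient Φ (x t)) J t := by
  obtain ⟨x1, x2⟩ := hasDerivWithinAt_dot hJ hx ht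
  obtain ⟨a1, a2⟩ := hasDerivWithinAt_dot hJ ha ht
  have hg : HasDerivWithinAt (fun s => gradient Φ (x s))
      ((fderiv ℝ (gradient Φ) (x t)) (dot J x t)) J t :=
    (((contDiff_gradient hΦ).differentiable one_ne_zero) (x t)).hasFDerivAt.comp_hasDerivWithinAt
      t x1
  have := (x1.add ((a1.div a2 hda0).smul x2)).add (a2.smul hg)
  refine this.congr_deriv ?_
  simp only [coeffα, coeffβ, coeffb, Pi.div_apply]
  generalize dot J x t = X1 at *
  generalize ddot J x t = X2 at *
  generalize dot J a t = A1 at *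
  generalize ddot J a t = A2 at *
  generalize fderiv ℝ (gradient Φ) (x t) X1 = H at *
  generalize gradient Φ (x t) = G at *
  match_scalars <;> field_simp <;> ring

end Reduction

/-! ### Solutions of the system correspond to integral curves -/

section Equivalence

lemma hasDerivWithinAt_fst {F G : Type*} [NormedAddCommGroup F] [NormedSpace ℝ F]
    [NormedAddCommGroup G] [NormedSpace ℝ G] {J : Set ℝ} {u : ℝ → F × G} {u' : F × G} {t : ℝ}
    (h : HasDerivWithinAt u u' J t) : HasDerivWithinAt (fun t => (u t).1) u'.1 J t :=
  (ContinuousLinearMap.fst ℝ F G).hasFDerivAt.comp_hasDerivWithinAt t h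

lemma hasDerivWithinAt_snd {F G : Type*} [NormedAddCommGroup F] [NormedSpace ℝ F]
    [NormedAddCommGroup G] [NormedSpace ℝ G] {J : Set ℝ} {u : ℝ → F × G} {u' : F × G} {t : ℝ}
    (h : HasDerivWithinAt u u' J t) : HasDerivWithinAt (fun t => (u t).2) u'.2 J t :=
  (ContinuousLinearMap.snd ℝ F G).hasFDerivAt.comp_hasDerivWithinAt t h

variable {d : ℕ}

lemma isSolution_of_isCurveIn {Φ : EuclideanSpace ℝ (Fin d) → ℝ} (hΦ : ContDiff ℝ 2 Φ) {p : ℕ}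
    (hp : 1 ≤ p) {θ c : ℝ} (hθ : 0 < θ) {x₀ w₀ : EuclideanSpace ℝ (Fin d)} {J : Set ℝ}
    (hJ : UniqueDiffOn ℝ J) (hJc : J.OrdConnected) (h0J : (0 : ℝ) ∈ J) (hJ0 : J ⊆ Ici 0)
    {u : ℝ → EuclideanSpace ℝ (Fin d) × EuclideanSpace ℝ (Fin d) × ℝ}
    (hu : IsCurveIn (field Φ p θ) (domain Φ p) J u) (hx0 : (u 0).1 = x₀)
    (hv0 : (field Φ p θ (u 0)).1 = w₀) (hs0 : (u 0).2.2 = c) :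
    IsSolution Φ p θ c x₀ w₀ J (fun t => (u t).1) (fun t => rate Φ p θ (u t).1 ^ 2)
      (fun t => (u t).2.2 ^ 2 / 4) := by
  have hu1 : ContDiffOn ℝ 1 u J := by
    rw [contDiffOn_one_iff_derivWithin hJ]
    refine ⟨fun t ht => (hu t ht).2.differentiableWithinAt, ?_⟩
    exact (((contDiffOn_field hΦ p hθ).continuousOn.comp hu.continuousOn
      fun t ht => (hu t ht).1)).congr fun t ht => (hu t ht).2.derivWithin (hJ t ht)
  -- Bootstrap: `u` is C¹ and the field is C¹, so `u' = field ∘ u` is C¹.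
  have hu2 : ContDiffOn ℝ 2 u J := by
    suffices h : ContDiffOn ℝ (1 + 1) u J by
      rwa [one_add_one_eq_two] at h
    rw [contDiffOn_succ_iff_derivWithin hJ]
    refine ⟨fun t ht => (hu t ht).2.differentiableWithinAt, by simp, ?_⟩
    exact ((contDiffOn_field hΦ p hθ).comp hu1 fun t ht => (hu t ht).1).congr
      fun t ht => (hu t ht).2.derivWithin (hJ t ht)
  have hx2 : ContDiffOn ℝ 2 (fun t => (u t).1) J := contDiff_fst.comp_contDiffOn hu2
  have hs2 : ContDiffOn ℝ 2 (fun t => (u t).2.2) J :=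
    (contDiff_snd.comp contDiff_snd).comp_contDiffOn hu2
  have ha2 : ContDiffOn ℝ 2 (fun t => (u t).2.2 ^ 2 / 4) J := (hs2.pow 2).div_const 4
  have hrpos : ∀ t ∈ J, 0 < rate Φ p θ (u t).1 := fun t ht => rate_pos hθ (hu t ht).1.1
  have hspos : ∀ t ∈ J, 0 < (u t).2.2 := fun t ht => (hu t ht).1.2
  have hdx : ∀ t ∈ J, HasDerivWithinAt (fun t => (u t).1) (field Φ p θ (u t)).1 J t :=
    fun t ht => hasDerivWithinAt_fst (hu t ht).2
  have hdv : ∀ t ∈ J, HasDerivWithinAt (fun t => (u t).2.1) (field Φ p θ (u t)).2.1 J t :=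
    fun t ht => hasDerivWithinAt_fst (hasDerivWithinAt_snd (hu t ht).2)
  have hds : ∀ t ∈ J, HasDerivWithinAt (fun t => (u t).2.2) (rate Φ p θ (u t).1) J t :=
    fun t ht => hasDerivWithinAt_snd (hasDerivWithinAt_snd (hu t ht).2)
  have hdotx : ∀ t ∈ J, dot J (fun t => (u t).1) t = (field Φ p θ (u t)).1 :=
    fun t ht => (hdx t ht).derivWithin (hJ t ht)
  have hdota : ∀ t ∈ J, dot J (fun t => (u t).2.2 ^ 2 / 4) t
      = (u t).2.2 * rate Φ p θ (u t).1 / 2 := by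
    intro t ht
    refine ((((hds t ht).pow 2).div_const 4).congr_deriv ?_).derivWithin (hJ t ht)
    ring
  have hrc : ContinuousOn (fun t => rate Φ p θ (u t).1) J :=
    (contDiffOn_rate hΦ p hθ).continuousOn.comp hx2.continuousOn fun t ht => (hu t ht).1.1
  refine ⟨hx2, ha2, hrc.pow 2, fun t ht => pow_pos (hrpos t ht) 2,
    fun t ht => by have := hspos t ht; positivity, fun t ht => ?_, fun t ht => ?_,
    fun t ht => rate_feedback hp hθ (hu t ht).1.1, hx0, ?_⟩
  · have hda : 0 < dot J (fun t => (u t).2.2 ^ 2 / 4) t := by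
      rw [hdota t ht]
      exact half_pos (mul_pos (hspos t ht) (hrpos t ht))
    have ha : 0 < (u t).2.2 ^ 2 / 4 := by have := hspos t ht; positivity
    have h1 := hasDerivWithinAt_averaged hΦ hJ hx2 ha2 ht ha.ne' hda.ne'
    have heq : EqOn (averaged Φ J (fun t => (u t).1) (fun t => (u t).2.2 ^ 2 / 4))
        (fun t => (u t).2.1) J := by
      intro r hr
      simp only [averaged, hdota r hr, hdotx r hr, field]
      have := (hspos r hr).ne'
      have := (hrpos r hr).ne'
      match_scalars <;> field_simp <;> ring
    have h2 := (hdv t ht).congr heq (heq ht)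
    -- Comparing the two derivatives of `v` shows that `a / ȧ` times the left side of the equation
    -- vanishes.
    have h3 := (hJ t ht).eq_deriv _ h1 h2
    rw [hdota t ht] at h3
    have h4 : (field Φ p θ (u t)).2.1
      = - (((u t).2.2 * rate Φ p θ (u t).1 / 2) • gradient Φ (u t).1) := rfl
    rw [h4, sub_eq_neg_self, ← hdota t ht] at h3
    exact (smul_eq_zero.1 h3).resolve_left (div_pos ha hda).ne'
  · have hsub : Icc 0 t ⊆ J := hJc.out h0J ht
    have h1 : ∫ s in (0 : ℝ)..t, √(rate Φ p θ (u s).1 ^ 2) = (u t).2.2 - (u 0).2.2 := by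
      rw [← intervalIntegral.integral_eq_sub_of_hasDerivAt_of_le (hJ0 ht)
        (f' := fun s => rate Φ p θ (u s).1) (hs2.continuousOn.mono hsub)]
      · refine intervalIntegral.integral_congr fun s hs => ?_
        rw [uIcc_of_le (hJ0 ht)] at hs
        exact Real.sqrt_sq (hrpos s (hsub hs)).le
      · intro s hs
        exact (hds s (hsub (Ioo_subset_Icc_self hs))).hasDerivAt
          (mem_of_superset (Icc_mem_nhds hs.1 hs.2) hsub)
      · exact ContinuousOn.intervalIntegrable (by rw [uIcc_of_le (hJ0 ht)]; exact hrc.mono hsub)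
    rw [h1, hs0]
    ring
  · rw [hdotx 0 h0J, hv0]

/-- The first-order curve attached to a solution. -/
def curveOf (Φ : EuclideanSpace ℝ (Fin d) → ℝ) (c : ℝ) (x : ℝ → EuclideanSpace ℝ (Fin d))
    (lam a : ℝ → ℝ) (t : ℝ) : EuclideanSpace ℝ (Fin d) × EuclideanSpace ℝ (Fin d) × ℝ :=
  (x t, averaged Φ (Ici 0) x a t, (∫ s in (0 : ℝ)..t, √(lam s)) + c)

/-- Replacing `r` by `r (max 0 s)` gives a continuous function on the whole line with the same
integrals from 0. -/
lemma hasDerivWithinAt_integral_Ici {r : ℝ → ℝ} (hr : ContinuousOn r (Ici 0)) {t : ℝ}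
    (ht : 0 ≤ t) : HasDerivWithinAt (fun t => ∫ s in (0 : ℝ)..t, r s) (r t) (Ici 0) t := by
  have hc : Continuous fun s => r (max 0 s) :=
    hr.comp_continuous (continuous_const.max continuous_id) fun s => le_max_left 0 s
  have h1 := (hc.integral_hasStrictDerivAt 0 t).hasDerivAt.hasDerivWithinAt (s := Ici 0)
  rw [max_eq_right ht] at h1
  have heq : EqOn (fun t => ∫ s in (0 : ℝ)..t, r s) (fun t => ∫ s in (0 : ℝ)..t, r (max 0 s))
      (Ici 0) := fun q hq => by
    refine intervalIntegral.integral_congr fun s hs => ?_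
    rw [uIcc_of_le hq] at hs
    simp only [max_eq_right hs.1]
  exact h1.congr heq (heq ht)

section

variable {Φ : EuclideanSpace ℝ (Fin d) → ℝ} {p : ℕ} {θ c : ℝ}
  {x₀ w₀ : EuclideanSpace ℝ (Fin d)} {x : ℝ → EuclideanSpace ℝ (Fin d)} {lam a : ℝ → ℝ}

lemma IsSolution.hasDerivWithinAt_integral (h : IsSolution Φ p θ c x₀ w₀ (Ici 0) x lam a)
    (hp : 1 ≤ p) (hθ : 0 < θ) {t : ℝ} (ht : 0 ≤ t) :
    HasDerivWithinAt (fun t => (∫ s in (0 : ℝ)..t, √(lam s)) + c) (rate Φ p θ (x t)) (Ici 0) t := by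
  have h1 := (hasDerivWithinAt_integral_Ici h.lam_cont.sqrt ht).add_const c
  rwa [sqrt_eq_rate_of_feedback hp hθ (h.lam_pos t ht) (h.feedback t ht)] at h1

lemma IsSolution.dot_a (h : IsSolution Φ p θ c x₀ w₀ (Ici 0) x lam a)
    (hp : 1 ≤ p) (hθ : 0 < θ) {t : ℝ} (ht : 0 ≤ t) :
    dot (Ici 0) a t = ((∫ s in (0 : ℝ)..t, √(lam s)) + c) * rate Φ p θ (x t) / 2 := by
  have h1 := ((h.hasDerivWithinAt_integral hp hθ ht).pow 2).const_mul (1 / 4 : ℝ)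
  have h2 : HasDerivWithinAt a _ (Ici 0) t := h1.congr (fun s hs => h.a_eq s hs) (h.a_eq t ht)
  rw [dot, h2.derivWithin (uniqueDiffOn_Ici 0 t ht)]
  simp only [Nat.add_one_sub_one, pow_one, Nat.cast_ofNat]
  ring

lemma IsSolution.isCurveIn (h : IsSolution Φ p θ c x₀ w₀ (Ici 0) x lam a)
    (hΦ : ContDiff ℝ 2 Φ) (hp : 1 ≤ p) (hθ : 0 < θ) (hc : 0 < c) :
    IsCurveIn (field Φ p θ) (domain Φ p) (Ici 0) (curveOf Φ c x lam a) := by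
  intro t ht
  have hreg := mem_regular_of_feedback hθ (h.lam_pos t ht) (h.feedback t ht)
  have hr := rate_pos hθ hreg
  have hs : 0 < (∫ s in (0 : ℝ)..t, √(lam s)) + c := by
    have : 0 ≤ ∫ s in (0 : ℝ)..t, √(lam s) :=
      intervalIntegral.integral_nonneg ht fun s _ => Real.sqrt_nonneg _
    linarith
  have hJ : UniqueDiffOn ℝ (Ici (0 : ℝ)) := uniqueDiffOn_Ici 0
  have hda := h.dot_a hp hθ ht
  have hda0 : dot (Ici 0) a t ≠ 0 := by rw [hda]; positivity
  refine ⟨⟨hreg, hs⟩, ?_⟩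
  have hv := hasDerivWithinAt_averaged hΦ hJ h.x_smooth h.a_smooth ht (h.a_pos t ht).ne' hda0
  rw [h.ode t ht, smul_zero, zero_sub] at hv
  refine ((hasDerivWithinAt_dot hJ h.x_smooth ht).1.prodMk
    (hv.prodMk (h.hasDerivWithinAt_integral hp hθ ht))).congr_deriv ?_
  simp only [field, curveOf, averaged, hda, h.a_eq t ht, Prod.mk.injEq, and_true]
  match_scalars <;> field_simp <;> ring

/-- The starting point depends on the data alone, so the curves of any two solutions start together.
-/
lemma IsSolution.curveOf_zero (h : IsSolution Φ p θ c x₀ w₀ (Ici 0) x lam a)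
    (hp : 1 ≤ p) (hθ : 0 < θ) :
    curveOf Φ c x lam a 0 = (x₀, x₀ + (1 / 4 * c ^ 2 / (c * rate Φ p θ x₀ / 2)) • w₀
      + (c * rate Φ p θ x₀ / 2) • gradient Φ x₀, c) := by
  have h1 := h.dot_a hp hθ le_rfl
  have h2 := h.a_eq 0 self_mem_Ici
  simp only [intervalIntegral.integral_same, zero_add, h.init_pos] at h1 h2
  simp [curveOf, averaged, h1, h2, h.init_pos, h.init_vel]

end

end Equivalence

/-! ### A priori bounds on bounded time intervals -/

section Bounds

/-- On the segment from `x` to `z`, convexity bounds the initial derivative by the slope of the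
chord. -/
lemma inner_gradient_sub_ge {E : Type*} [NormedAddCommGroup E] [InnerProductSpace ℝ E]
    [CompleteSpace E] {Φ : E → ℝ} (hconv : ConvexOn ℝ univ Φ) (hΦ : Differentiable ℝ Φ) (x z : E) :
    Φ x - Φ z ≤ inner ℝ (gradient Φ x) (x - z) := by
  have h1 : ConvexOn ℝ univ (Φ ∘ AffineMap.lineMap (k := ℝ) x z) := by
    simpa using hconv.comp_affineMap (AffineMap.lineMap (k := ℝ) x z)
  have h2 : HasDerivAt (Φ ∘ AffineMap.lineMap (k := ℝ) x z) (fderiv ℝ Φ x (z - x)) 0 := by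
    have h3 : HasFDerivAt Φ (fderiv ℝ Φ x) (AffineMap.lineMap (k := ℝ) x z (0 : ℝ)) := by
      simpa using (hΦ x).hasFDerivAt
    exact h3.comp_hasDerivAt 0 AffineMap.hasDerivAt_lineMap
  have h4 := h1.le_slope_of_hasDerivAt (mem_univ 0) (mem_univ 1) one_pos h2
  rw [← inner_gradient_left, slope_def_field] at h4
  simp only [Function.comp_apply, AffineMap.lineMap_apply_one, AffineMap.lineMap_apply_zero,
    sub_zero, div_one] at h4
  rw [← neg_sub z x, inner_neg_right]
  linarith

lemma AbsContOn.bddAbove_Ico {f : ℝ → ℝ} {T : ℝ} (hT : 0 < T) (hf : AbsContOn f (Ico 0 T))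
    (hc : ContinuousOn f (Ico 0 T)) : ∃ M, ∀ t ∈ Ico 0 T, f t ≤ M := by
  obtain ⟨δ, hδ, h⟩ := hf 1 one_pos
  -- Any `[t₀, t]` with `t < T` is shorter than `δ`, so a single interval suffices: `f` exceeds `f
  -- t₀` by less than 1 there.
  set t₀ := max 0 (T - δ / 2) with ht₀
  have ht₀T : t₀ < T := max_lt hT (by linarith)
  have h0 : 0 ≤ t₀ := le_max_left _ _
  have hδ' : T - δ / 2 ≤ t₀ := le_max_right _ _
  obtain ⟨M, hM⟩ := (isCompact_Icc.image_of_continuousOn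
    (hc.mono fun t (ht : t ∈ Icc 0 t₀) => ⟨ht.1, ht.2.trans_lt ht₀T⟩)).bddAbove
  refine ⟨M + 1, fun t ht => ?_⟩
  rcases le_total t t₀ with htt | htt
  · linarith [hM (mem_image_of_mem f (show t ∈ Icc 0 t₀ from ⟨ht.1, htt⟩))]
  · have h1 := h 1 (fun _ => t₀) (fun _ => t)
      (fun _ => ⟨htt, fun s hs => ⟨h0.trans hs.1, hs.2.trans_lt ht.2⟩⟩)
      (fun i j hij => absurd (Subsingleton.elim i j) hij)
      (by simp only [Finset.univ_unique, Finset.sum_const, Finset.card_singleton, one_smul]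
          linarith [ht.2])
    simp only [Finset.univ_unique, Finset.sum_const, Finset.card_singleton, one_smul] at h1
    linarith [(abs_lt.1 h1).2, hM (mem_image_of_mem f (show t₀ ∈ Icc 0 t₀ from ⟨h0, le_rfl⟩))]

variable {E : Type*} [NormedAddCommGroup E] [InnerProductSpace ℝ E] [CompleteSpace E]
  {Φ : E → ℝ} {p : ℕ} {θ : ℝ} {J : Set ℝ} {u : ℝ → E × E × ℝ} {z : E}

/-- The derivative is `ȧ (Φ(x) - Φ(z) - ⟨∇Φ(x), x - z⟩) - ȧ² ‖∇Φ(x)‖²`; the first term is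
nonpositive by convexity. -/
lemma antitoneOn_energy (hconv : ConvexOn ℝ univ Φ) (hΦ : ContDiff ℝ 2 Φ) (hθ : 0 < θ)
    (hJ : Convex ℝ J) (hu : IsCurveIn (field Φ p θ) (domain Φ p) J u) :
    AntitoneOn (fun t => (u t).2.2 ^ 2 / 4 * (Φ (u t).1 - Φ z) + ‖(u t).2.1 - z‖ ^ 2 / 2) J := by
  have hd : Differentiable ℝ Φ := hΦ.differentiable two_ne_zero
  have key : ∀ t ∈ J, ∃ e, e ≤ 0 ∧ HasDerivWithinAt
      (fun t => (u t).2.2 ^ 2 / 4 * (Φ (u t).1 - Φ z) + ‖(u t).2.1 - z‖ ^ 2 / 2) e J t := by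
    intro t ht
    obtain ⟨⟨hreg, hs⟩, hut⟩ := hu t ht
    have hr := rate_pos hθ hreg
    have hx := hasDerivWithinAt_fst hut
    have hv := hasDerivWithinAt_fst (hasDerivWithinAt_snd hut)
    have hss := hasDerivWithinAt_snd (hasDerivWithinAt_snd hut)
    have hΦx : HasDerivWithinAt (fun t => Φ (u t).1)
        (inner ℝ (gradient Φ (u t).1) (field Φ p θ (u t)).1) J t := by
      rw [inner_gradient_left]
      exact (hd (u t).1).hasFDerivAt.comp_hasDerivWithinAt t hx
    refine ⟨_, ?_, (((hss.pow 2).div_const 4).mul (hΦx.sub_const (Φ z))).add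
      ((hv.sub_const z).norm_sq.div_const 2)⟩
    have hi := inner_gradient_sub_ge hconv hd (u t).1 z
    simp only [field, Pi.pow_apply]
    generalize rate Φ p θ (u t).1 = r at *
    generalize gradient Φ (u t).1 = g at *
    generalize Φ (u t).1 - Φ z = D at *
    generalize (u t).2.2 = s at *
    generalize (u t).2.1 = v at *
    generalize (u t).1 = x at *
    simp only [inner_sub_right, inner_smul_right, inner_neg_right, inner_sub_left] at hi ⊢
    rw [real_inner_comm g v, real_inner_comm g z, real_inner_self_eq_norm_sq]
    have h1 : 0 ≤ s * r / 2 * (inner ℝ g x - inner ℝ g z - D) :=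
      mul_nonneg (by positivity) (by linarith)
    have h2 : 0 ≤ (s * r / 2 * ‖g‖) ^ 2 := sq_nonneg _
    have h3 : s ^ 2 / 4 * (2 * r / s * (inner ℝ g v - inner ℝ g x - s * r / 2 * ‖g‖ ^ 2))
      = s * r / 2 * (inner ℝ g v - inner ℝ g x) - (s * r / 2 * ‖g‖) ^ 2 := by
      field_simp
      ring
    rw [h3]
    norm_num
    linarith
  choose! e he hde using key
  exact antitoneOn_of_hasDerivWithinAt_nonpos hJ (fun t ht => (hde t ht).continuousWithinAt)
    (fun t ht => (hde t (interior_subset ht)).mono interior_subset)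
    fun t ht => he t (interior_subset ht)

/-- The motion pulls `x` towards `v`, the gradient term only helps since `⟨∇Φ(x), x - z⟩ ≥ 0`, and
the weight `s²` absorbs the singular-looking factor `1 / s`. What remains is `2⟨x - z, v - z⟩ ≤ ‖x -
z‖² + R`. -/
lemma antitoneOn_position_energy (hconv : ConvexOn ℝ univ Φ) (hΦ : ContDiff ℝ 2 Φ) (hθ : 0 < θ)
    (hz : ∀ y, Φ z ≤ Φ y) (hJ : Convex ℝ J)
    (hu : IsCurveIn (field Φ p θ) (domain Φ p) J u) {R : ℝ}
    (hR : ∀ t ∈ J, ‖(u t).2.1 - z‖ ^ 2 ≤ R) :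
    AntitoneOn (fun t => (u t).2.2 ^ 2 * (‖(u t).1 - z‖ ^ 2 - R)) J := by
  have hd : Differentiable ℝ Φ := hΦ.differentiable two_ne_zero
  have key : ∀ t ∈ J, ∃ e, e ≤ 0 ∧ HasDerivWithinAt
      (fun t => (u t).2.2 ^ 2 * (‖(u t).1 - z‖ ^ 2 - R)) e J t := by
    intro t ht
    obtain ⟨⟨hreg, hs⟩, hut⟩ := hu t ht
    have hr := rate_pos hθ hreg
    have hx := hasDerivWithinAt_fst hut
    have hss := hasDerivWithinAt_snd (hasDerivWithinAt_snd hut)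
    refine ⟨_, ?_, (hss.pow 2).mul ((hx.sub_const z).norm_sq.sub_const R)⟩
    have hi := (sub_nonneg.2 (hz (u t).1)).trans (inner_gradient_sub_ge hconv hd (u t).1 z)
    have hRt := hR t ht
    have hxv : 2 * inner ℝ ((u t).1 - z) ((u t).2.1 - z)
        ≤ ‖(u t).1 - z‖ ^ 2 + ‖(u t).2.1 - z‖ ^ 2 := by
      have h1 := real_inner_le_norm ((u t).1 - z) ((u t).2.1 - z)
      have h2 := two_mul_le_add_sq ‖(u t).1 - z‖ ‖(u t).2.1 - z‖
      linarith
    have hsplit : (u t).2.1 - (u t).1 = ((u t).2.1 - z) - ((u t).1 - z) := by abel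
    simp only [field, Pi.pow_apply]
    rw [hsplit]
    generalize rate Φ p θ (u t).1 = r at *
    generalize gradient Φ (u t).1 = g at *
    generalize (u t).2.2 = s at *
    generalize (u t).2.1 - z = v at *
    generalize (u t).1 - z = x at *
    simp only [inner_sub_right, inner_smul_right, real_inner_self_eq_norm_sq]
    rw [real_inner_comm] at hi
    have h1 : 0 ≤ s * r * (s * r / 2 * inner ℝ x g) := by positivity
    have h2 : 0 ≤ s * r * (‖x‖ ^ 2 + R - 2 * inner ℝ x v) :=
      mul_nonneg (by positivity) (by linarith)
    have h3 : s ^ 2 * (2 * (2 * r / s * (inner ℝ x v - ‖x‖ ^ 2 - s * r / 2 * inner ℝ x g)))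
      = s * r * (4 * inner ℝ x v - 4 * ‖x‖ ^ 2) - 4 * (s * r * (s * r / 2 * inner ℝ x g)) := by
      field_simp
      ring
    rw [h3]
    norm_num
    linarith
  choose! e he hde using key
  exact antitoneOn_of_hasDerivWithinAt_nonpos hJ (fun t ht => (hde t ht).continuousWithinAt)
    (fun t ht => (hde t (interior_subset ht)).mono interior_subset)
    fun t ht => he t (interior_subset ht)

/-- A curve on a bounded time interval along which `√λ` is bounded stays in a compact subset of
the domain. -/
lemma exists_isCompact_mapsTo [ProperSpace E] (hconv : ConvexOn ℝ univ Φ) (hΦ : ContDiff ℝ 2 Φ)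
    (hp : 1 ≤ p) (hθ : 0 < θ) (hz : ∀ y, Φ z ≤ Φ y) {T : ℝ} (hT : 0 < T)
    (hu : IsCurveIn (field Φ p θ) (domain Φ p) (Ico 0 T) u) {M : ℝ}
    (hM : ∀ t ∈ Ico 0 T, rate Φ p θ (u t).1 ^ 2 ≤ M) :
    ∃ K, IsCompact K ∧ K ⊆ domain Φ p ∧ MapsTo u (Ico 0 T) K := by
  have h0 : (0 : ℝ) ∈ Ico 0 T := ⟨le_rfl, hT⟩
  have hs0 := (hu 0 h0).1.2
  have hrpos : ∀ t ∈ Ico 0 T, 0 < rate Φ p θ (u t).1 := fun t ht => rate_pos hθ (hu t ht).1.1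
  have hMpos : 0 < M := (pow_pos (hrpos 0 h0) 2).trans_le (hM 0 h0)
  have hds : ∀ t ∈ Ico 0 T,
      HasDerivWithinAt (fun t => (u t).2.2) (rate Φ p θ (u t).1) (Ico 0 T) t :=
    fun t ht => hasDerivWithinAt_snd (hasDerivWithinAt_snd (hu t ht).2)
  have hmono : MonotoneOn (fun t => (u t).2.2) (Ico 0 T) :=
    monotoneOn_of_hasDerivWithinAt_nonneg (convex_Ico 0 T)
      (fun t ht => (hds t ht).continuousWithinAt)
      (fun t ht => (hds t (interior_subset ht)).mono interior_subset)
      fun t ht => (hrpos t (interior_subset ht)).le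
  have hsub : ∀ t ∈ Ico 0 T, HasDerivWithinAt (fun t => (u t).2.2 - √M * t)
      (rate Φ p θ (u t).1 - √M * 1) (Ico 0 T) t :=
    fun t ht => (hds t ht).sub ((hasDerivWithinAt_id t _).const_mul _)
  have hanti : AntitoneOn (fun t => (u t).2.2 - √M * t) (Ico 0 T) :=
    antitoneOn_of_hasDerivWithinAt_nonpos (convex_Ico 0 T)
      (fun t ht => (hsub t ht).continuousWithinAt)
      (fun t ht => (hsub t (interior_subset ht)).mono interior_subset)
      fun t ht => by
        have := Real.le_sqrt_of_sq_le (hM t (interior_subset ht))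
        linarith
  obtain ⟨R, hR⟩ : ∃ R, ∀ t ∈ Ico 0 T, ‖(u t).2.1 - z‖ ^ 2 ≤ R := by
    refine ⟨2 * ((u 0).2.2 ^ 2 / 4 * (Φ (u 0).1 - Φ z) + ‖(u 0).2.1 - z‖ ^ 2 / 2),
      fun t ht => ?_⟩
    have h1 := antitoneOn_energy (z := z) hconv hΦ hθ (convex_Ico 0 T) hu h0 ht ht.1
    have h2 : 0 ≤ (u t).2.2 ^ 2 / 4 * (Φ (u t).1 - Φ z) :=
      mul_nonneg (by positivity) (sub_nonneg.2 (hz _))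
    simp only at h1
    linarith
  obtain ⟨R', hR'⟩ : ∃ R', ∀ t ∈ Ico 0 T, ‖(u t).1 - z‖ ^ 2 ≤ R' := by
    -- The absolute value permits replacing `s(0)²` by the larger `s(t)²`, which then cancels.
    refine ⟨R + |‖(u 0).1 - z‖ ^ 2 - R|, fun t ht => ?_⟩
    have h1 := antitoneOn_position_energy hconv hΦ hθ hz (convex_Ico 0 T) hu hR h0 ht ht.1
    have h2 : (u 0).2.2 ^ 2 ≤ (u t).2.2 ^ 2 := pow_le_pow_left₀ hs0.le (hmono h0 ht ht.1) 2
    have h3 := le_abs_self (‖(u 0).1 - z‖ ^ 2 - R)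
    have h4 := abs_nonneg (‖(u 0).1 - z‖ ^ 2 - R)
    simp only at h1
    have h5 : (u t).2.2 ^ 2 * (‖(u t).1 - z‖ ^ 2 - R)
        ≤ (u t).2.2 ^ 2 * |‖(u 0).1 - z‖ ^ 2 - R| :=
      h1.trans ((mul_le_mul_of_nonneg_left h3 (sq_nonneg _)).trans
        (mul_le_mul_of_nonneg_right h2 h4))
    have h6 := le_of_mul_le_mul_left h5 (pow_pos (hu t ht).1.2 2)
    linarith
  -- The last condition is `λ ≤ M` read through the feedback law; it is closed and keeps the set
  -- inside `regular`.
  refine ⟨(Metric.closedBall z (√R') ×ˢ Metric.closedBall z (√R) ×ˢ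
      Icc (u 0).2.2 ((u 0).2.2 + √M * T)) ∩ {q | θ / M ^ p ≤ ‖gradient Φ q.1‖ ^ (p - 1)},
    ((isCompact_closedBall _ _).prod ((isCompact_closedBall _ _).prod isCompact_Icc)).inter_right
      (isClosed_le continuous_const
        (((contDiff_gradient hΦ).continuous.comp continuous_fst).norm.pow _)), ?_, ?_⟩
  · rintro q ⟨⟨-, -, hq⟩, hq'⟩
    exact ⟨(div_pos hθ (pow_pos hMpos p)).trans_le hq', hs0.trans_le hq.1⟩
  · intro t ht
    refine ⟨⟨?_, ?_, hmono h0 ht ht.1, ?_⟩, ?_⟩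
    · rw [mem_closedBall_iff_norm]
      exact Real.le_sqrt_of_sq_le (hR' t ht)
    · rw [mem_closedBall_iff_norm]
      exact Real.le_sqrt_of_sq_le (hR t ht)
    · have h1 := hanti h0 ht ht.1
      have h2 : √M * t ≤ √M * T := mul_le_mul_of_nonneg_left ht.2.le (Real.sqrt_nonneg _)
      simp only [mul_zero, sub_zero] at h1
      linarith
    · have hreg : 0 < ‖gradient Φ (u t).1‖ ^ (p - 1) := (hu t ht).1.1
      rw [mem_ofPred_eq, div_le_iff₀ (pow_pos hMpos p)]
      calc θ = (rate Φ p θ (u t).1 ^ 2) ^ p * ‖gradient Φ (u t).1‖ ^ (p - 1) :=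
            (rate_feedback hp hθ (hu t ht).1.1).symm
        _ ≤ M ^ p * ‖gradient Φ (u t).1‖ ^ (p - 1) := by
            gcongr
            exact hM t ht
        _ = _ := mul_comm _ _

end Bounds

end ClosedLoop

end

/-! ### Global existence and uniqueness -/

theorem mainTheorem2 {d : ℕ} (Φ : EuclideanSpace ℝ (Fin d) → ℝ)
    (hΦconv : ConvexOn ℝ Set.univ Φ) (hΦsmooth : ContDiff ℝ 2 Φ)
    (hΦmin : ∃ z, ∀ y, Φ z ≤ Φ y)
    (p : ℕ) (hp : 1 ≤ p) (θ c : ℝ) (hθ0 : 0 < θ) (hθ1 : θ < 1) (hc : 0 < c)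
    (x₀ w₀ : EuclideanSpace ℝ (Fin d)) (hx₀ : gradient Φ x₀ ≠ 0)
    -- along every solution on a bounded interval `[0, T)`, `λ` is absolutely continuous on `[0, T)`
    (hAC : ∀ T : ℝ, 0 < T → ∀ (x : ℝ → EuclideanSpace ℝ (Fin d)) (lam a : ℝ → ℝ),
      ClosedLoop.IsSolution Φ p θ c x₀ w₀ (Set.Ico 0 T) x lam a →
      ClosedLoop.AbsContOn lam (Set.Ico 0 T)) :
    ∃ (x : ℝ → EuclideanSpace ℝ (Fin d)) (lam a : ℝ → ℝ),
      ClosedLoop.IsSolution Φ p θ c x₀ w₀ (Set.Ici 0) x lam a ∧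
      ∀ (x' : ℝ → EuclideanSpace ℝ (Fin d)) (lam' a' : ℝ → ℝ),
        ClosedLoop.IsSolution Φ p θ c x₀ w₀ (Set.Ici 0) x' lam' a' →
        Set.EqOn x' x (Set.Ici 0) ∧ Set.EqOn lam' lam (Set.Ici 0) ∧
          Set.EqOn a' a (Set.Ici 0) := by
  open ClosedLoop in
  obtain ⟨z, hz⟩ := hΦmin
  have hreg : x₀ ∈ regular Φ p := pow_pos (norm_pos_iff.2 hx₀) _
  have hr := rate_pos hθ0 hreg
  -- Here `a(0) = c² / 4` and `ȧ(0) = c √λ(0) / 2`; the middle entry is the averaged position that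
  -- encodes `ẋ(0) = w₀`.
  set q₀ : EuclideanSpace ℝ (Fin d) × EuclideanSpace ℝ (Fin d) × ℝ :=
    (x₀, x₀ + (1 / 4 * c ^ 2 / (c * rate Φ p θ x₀ / 2)) • w₀
      + (c * rate Φ p θ x₀ / 2) • gradient Φ x₀, c) with hq₀
  have hfield : (field Φ p θ q₀).1 = w₀ := by
    simp only [field, hq₀]
    match_scalars <;> field_simp <;> ring
  have hsol : ∀ (J : Set ℝ) (u : ℝ → _), UniqueDiffOn ℝ J → J.OrdConnected → (0 : ℝ) ∈ J →
      J ⊆ Set.Ici 0 → u 0 = q₀ → IsCurveIn (field Φ p θ) (domain Φ p) J u →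
      IsSolution Φ p θ c x₀ w₀ J (fun t => (u t).1) (fun t => rate Φ p θ (u t).1 ^ 2)
        (fun t => (u t).2.2 ^ 2 / 4) := fun J u h1 h2 h3 h4 h5 h6 =>
    isSolution_of_isCurveIn hΦsmooth hp hθ0 h1 h2 h3 h4 h6 (by rw [h5]) (by rw [h5, hfield])
      (by rw [h5])
  obtain ⟨u, hu0, hu⟩ := exists_isCurveIn_Ici (isOpen_domain hΦsmooth p)
    (contDiffOn_field hΦsmooth p hθ0) (u₀ := q₀) ⟨hreg, hc⟩ fun T hT u hu0 hu => by
      have h1 := hsol _ u (uniqueDiffOn_Ico 0 T) Set.ordConnected_Ico ⟨le_rfl, hT⟩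
        Set.Ico_subset_Ici_self hu0 hu
      obtain ⟨M, hM⟩ := (hAC T hT _ _ _ h1).bddAbove_Ico hT h1.lam_cont
      exact exists_isCompact_mapsTo hΦconv hΦsmooth hp hθ0 hz hT hu hM
  refine ⟨_, _, _, hsol _ u (uniqueDiffOn_Ici 0) Set.ordConnected_Ici Set.self_mem_Ici
    subset_rfl hu0 hu, fun x' lam' a' h' => ?_⟩
  have heq : Set.EqOn (curveOf Φ c x' lam' a') u (Set.Ici 0) :=
    (h'.isCurveIn hΦsmooth hp hθ0 hc).eqOn_Ici (isOpen_domain hΦsmooth p)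
      (contDiffOn_field hΦsmooth p hθ0) hu (by rw [h'.curveOf_zero hp hθ0, hu0])
  have hx : Set.EqOn x' (fun t => (u t).1) (Set.Ici 0) := fun t ht => congrArg Prod.fst (heq ht)
  refine ⟨hx, fun t ht => ?_, fun t ht => ?_⟩
  · have := rate_sq_eq_of_feedback hp hθ0 (h'.lam_pos t ht) (h'.feedback t ht)
    rw [← this, hx ht]
  · have hs : (∫ s in (0 : ℝ)..t, √(lam' s)) + c = (u t).2.2 :=
      congrArg (fun q => q.2.2) (heq ht)
    rw [h'.a_eq t ht, hs]
    ring
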